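/- Let $K$ be a field and let $G$ be a finite simple graph with vertex set $V$ and edge set $E$. For $C\subseteq V$ let $\delta_C\in\{0,1\}^{E}$ be the vector whose entry at an edge $e$ is $1$ if $|C\cap e|=1$ and $0$ otherwise. Let $A_G$ be the integer matrix whose columns are the distinct vectors among the $\delta_C$ ($C\subseteq V$), each extended by one further entry equal to $1$. The cut ideal $I_G$ is the toric ideal of $A_G$ over $K$, that is, the kernel of the $K$-algebra homomorphism that sends the variable $x_j$ indexed by the $j$-th column $a_j$ of $A_G$ to the Laurent monomial $t^{a_j}$. Contracting an edge of a simple graph means merging its two end vertices, removing the edge and identifying any parallel edges that arise. Suppose that the complete bipartite graph $K_{2,3}$ is obtained (up to isomorphism) from $G$ by a finite, possibly empty, sequence of edge contractions. Then $I_G$ has no lexicographic quadratic Gröbner basis: for every ordering of the variables, $I_G$ has no Gröbner basis consisting of quadratic forms (homogeneous polynomials of degree $2$) with respect to the corresponding lexicographic order; in particular it has none consisting of quadratic binomials. -/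

import Mathlib

noncomputable section

/-- The toric ideal of an integer matrix `A`: the kernel of the `K`-algebra homomorphism from
`K[x_j : j a column of A]` to the Laurent polynomial ring `K[t_i^±1 : i a row of A]` (the monoid
algebra of `ℤ^d`) that sends `x_j` to the Laurent monomial whose exponent vector is column `j`. -/
def toricIdeal (K : Type*) [Field K] {d n : Type*} (A : Matrix d n ℤ) :
    Ideal (MvPolynomial n K) :=
  RingHom.ker (MvPolynomial.aeval
    (fun j : n => (AddMonoidAlgebra.single (fun i : d => A i j) 1 : AddMonoidAlgebra K (d → ℤ))))

open Classical in
/-- The cut vector `δ_C` of a vertex set `C`: its entry at an edge `e` is `1` if `|C ∩ e| = 1`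
and `0` otherwise. -/
def cutVector {V : Type*} (G : SimpleGraph V) (C : Set V) : G.edgeSet → ℤ :=
  fun e => if (C ∩ {x | x ∈ (e : Sym2 V)}).ncard = 1 then 1 else 0

/-- The index type of the columns of `A_G`: the pairwise distinct cut vectors of `G`. -/
abbrev CutVectors {V : Type*} (G : SimpleGraph V) : Type _ :=
  {δ : G.edgeSet → ℤ // δ ∈ Set.range (cutVector G)}

/-- The configuration `A_G`: its columns are the distinct cut vectors of `G`, each extended by an
entry `1` in one extra row (indexed by `Sum.inr ()`). -/
def cutMatrix {V : Type*} (G : SimpleGraph V) : Matrix (G.edgeSet ⊕ Unit) (CutVectors G) ℤ :=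
  fun i δ => Sum.elim δ.1 (fun _ => 1) i

/-- The cut ideal `I_G`. -/
def cutIdeal (K : Type*) [Field K] {V : Type*} (G : SimpleGraph V) :
    Ideal (MvPolynomial (CutVectors G) K) :=
  toricIdeal K (cutMatrix G)

/-- `B` is a Gröbner basis of `I` for the monomial order `m`: it is contained in `I`, and the
leading terms of its elements generate the initial ideal of `I`. -/
def IsGroebnerBasis {K : Type*} [Field K] {σ : Type*} (m : MonomialOrder σ)
    (I : Ideal (MvPolynomial σ K)) (B : Set (MvPolynomial σ K)) : Prop :=
  B ⊆ I ∧ Ideal.span (m.leadingTerm '' B) =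
    Ideal.span (m.leadingTerm '' (I : Set (MvPolynomial σ K)))

/-- `I` has a lexicographic quadratic Gröbner basis: for the lexicographic order that comes from
some linear ordering of the variables, `I` has a Gröbner basis consisting of quadratic forms. -/
def HasLexQuadraticGroebnerBasis {K : Type*} [Field K] {σ : Type*} [Finite σ]
    (I : Ideal (MvPolynomial σ K)) : Prop :=
  ∃ (_ : LinearOrder σ) (B : Set (MvPolynomial σ K)),
    IsGroebnerBasis (MonomialOrder.lex : MonomialOrder σ) I B ∧ ∀ g ∈ B, g.IsHomogeneous 2

/-- The graph obtained from `G` by merging the vertices `u` and `v`; loops are removed and parallel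
edges are identified. For adjacent `u`, `v` it is the contraction of the edge `uv`. -/
def contractEdge {V : Type*} (G : SimpleGraph V) (u v : V) :
    SimpleGraph (Quot fun a b : V => a = u ∧ b = v) :=
  G.map (Quot.mk fun a b : V => a = u ∧ b = v)

/-- `ContractsTo H G`: a graph isomorphic to `H` is obtained from `G` by a finite (possibly empty)
sequence of edge contractions. -/
inductive ContractsTo.{w, v} {W : Type w} (H : SimpleGraph W) :
    ∀ {V : Type v}, SimpleGraph V → Prop
  | of_iso {V : Type v} {G : SimpleGraph V} (e : G ≃g H) : ContractsTo H G
  | contract {V : Type v} {G : SimpleGraph V} {x y : V} (hxy : G.Adj x y)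
      (h : ContractsTo H (contractEdge G x y)) : ContractsTo H G

end

/-!
A toric ideal is spanned by binomials, so it has a quadratic Gröbner basis exactly when every
monomial that is not the smallest one of its `A`-degree is divisible by a quadratic monomial with
the same property. For lexicographic orders this passes to coordinate faces of the configuration,
and contracting connected parts of `G` amounts to passing to the face on which the contracted
edges are not cut. It remains to treat `K_{2,κ}`, whose cut vectors are the vertices of two cubes
with a common centre. All body diagonals of both cubes have the same degree; let `{r, r'}` be the
diagonal with the smallest monomial `x_r x_{r'}`, and `x_p` the largest variable from the cube not
containing `r`. For `m = card κ - 2 ≥ 1`, the monomial `x_p ^ m x_r x_{r'}` has the same degree as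
the product of the neighbours of `p`, all of which are smaller than `x_p`, so it is not the smallest
of its degree; but each of its quadratic divisors is.
-/

section GroebnerBasis

variable {K : Type*} [Field K] {σ : Type*} {m : MonomialOrder σ}

open MvPolynomial in
theorem isGroebnerBasis_iff_exists_degree_le {I : Ideal (MvPolynomial σ K)}
    {B : Set (MvPolynomial σ K)} :
    IsGroebnerBasis m I B ↔
      B ⊆ I ∧ ∀ f ∈ I, f ≠ 0 → ∃ g ∈ B, g ≠ 0 ∧ m.degree g ≤ m.degree f := by
  classical
  have hmem : ∀ f : MvPolynomial σ K, f ≠ 0 → (m.leadingTerm f ∈ Ideal.span (m.leadingTerm '' B) ↔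
      ∃ g ∈ B, g ≠ 0 ∧ m.degree g ≤ m.degree f) := by
    intro f hf
    rw [m.span_leadingTerm_eq_span_monomial',
      ← Set.image_image (fun s => monomial s (1 : K)) m.degree, mem_ideal_span_monomial_image,
      m.support_leadingTerm' hf]
    simp [and_assoc]
  refine and_congr_right fun hBI => ⟨fun h f hfI hf => ?_, fun h => le_antisymm ?_ ?_⟩
  · exact (hmem f hf).mp (h ▸ Ideal.subset_span (Set.mem_image_of_mem _ hfI))
  · exact Ideal.span_mono (Set.image_mono hBI)
  · rw [Ideal.span_le]
    rintro _ ⟨f, hfI, rfl⟩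
    rcases eq_or_ne f 0 with rfl | hf
    · simp
    · exact (hmem f hf).mpr (h f hfI hf)

end GroebnerBasis

section ToricIdeal

variable {K : Type*} [Field K] {d n : Type*} {A : Matrix d n ℤ}

/-- The `A`-degree `∑ j, u j • A.col j` of the monomial with exponent vector `u`. The fibres of
this map are the classes of monomials that are congruent modulo the toric ideal of `A`. -/
noncomputable def toricDegree (A : Matrix d n ℤ) : (n →₀ ℕ) →ₗ[ℕ] d → ℤ :=
  Finsupp.linearCombination ℕ A.col

theorem toricDegree_single (j : n) (k : ℕ) :
    toricDegree A (Finsupp.single j k) = k • A.col j :=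
  Finsupp.linearCombination_single ..

theorem toricDegree_single_add_single (x y : n) :
    toricDegree A (Finsupp.single x 1 + Finsupp.single y 1) = A.col x + A.col y := by
  rw [map_add, toricDegree_single, toricDegree_single, one_smul, one_smul]

theorem toricDegree_apply (u : n →₀ ℕ) (i : d) :
    toricDegree A u i = u.sum fun j k => k * A i j := by
  simp [toricDegree, Finsupp.linearCombination_apply, Finsupp.sum, Finset.sum_apply]

theorem mem_toricIdeal_iff_mapDomain_eq_zero {f : MvPolynomial n K} :
    f ∈ toricIdeal K A ↔
      AddMonoidAlgebra.mapDomainAlgHom K K (toricDegree A).toAddMonoidHom f = 0 := by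
  have haeval : MvPolynomial.aeval (fun j => (AddMonoidAlgebra.single (A.col j) 1 :
      AddMonoidAlgebra K (d → ℤ))) =
        AddMonoidAlgebra.mapDomainAlgHom K K (toricDegree A).toAddMonoidHom := by
    ext j : 1
    rw [MvPolynomial.aeval_X]
    exact (AddMonoidAlgebra.mapDomain_single.trans
      (congrArg (AddMonoidAlgebra.single · 1) ((toricDegree_single j 1).trans (one_smul ..)))).symm
  rw [← haeval]
  rfl

theorem monomial_sub_monomial_mem_toricIdeal {u v : n →₀ ℕ}
    (h : toricDegree A u = toricDegree A v) :
    (MvPolynomial.monomial u 1 - MvPolynomial.monomial v 1 : MvPolynomial n K) ∈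
      toricIdeal K A := by
  have hmap : ∀ w : n →₀ ℕ, AddMonoidAlgebra.mapDomainAlgHom K K (toricDegree A).toAddMonoidHom
      (MvPolynomial.monomial w 1) = AddMonoidAlgebra.single (toricDegree A w) 1 :=
    fun _ => AddMonoidAlgebra.mapDomain_single
  rw [mem_toricIdeal_iff_mapDomain_eq_zero, map_sub, sub_eq_zero]
  exact (hmap u).trans (h ▸ (hmap v).symm)

theorem sum_coeff_eq_zero_of_mem_toricIdeal [DecidableEq (d → ℤ)] {f : MvPolynomial n K}
    (hf : f ∈ toricIdeal K A) (u : n →₀ ℕ) :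
    ∑ v ∈ f.support with toricDegree A v = toricDegree A u, f.coeff v = 0 :=
  (Finsupp.mapDomain_apply_eq_sum (toricDegree A) (AddMonoidAlgebra.coeff f)).symm.trans
    (DFunLike.congr_fun (congrArg AddMonoidAlgebra.coeff
      (mem_toricIdeal_iff_mapDomain_eq_zero.mp hf)) (toricDegree A u))

theorem exists_mem_support_ne_toricDegree_eq {f : MvPolynomial n K} (hf : f ∈ toricIdeal K A)
    {u : n →₀ ℕ} (hu : u ∈ f.support) :
    ∃ v ∈ f.support, v ≠ u ∧ toricDegree A v = toricDegree A u := by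
  classical
  by_contra! hne
  have hfibre : f.support.filter (fun v => toricDegree A v = toricDegree A u) = {u} := by
    ext v
    simp only [Finset.mem_filter, Finset.mem_singleton]
    exact ⟨fun h => by_contra fun hvu => hne v h.1 hvu h.2, by rintro rfl; exact ⟨hu, rfl⟩⟩
  have hsum := sum_coeff_eq_zero_of_mem_toricIdeal hf u
  rw [hfibre, Finset.sum_singleton] at hsum
  exact MvPolynomial.mem_support_iff.mp hu hsum

end ToricIdeal

section InitialMonomials

open MonomialOrder

variable {K : Type*} [Field K] {d n : Type*} {A : Matrix d n ℤ} {m : MonomialOrder n} {k : ℕ}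

/-- `v` is the initial monomial of a homogeneous binomial of degree `k` in the toric ideal
of `A`. -/
def IsBinomialInitial (m : MonomialOrder n) (A : Matrix d n ℤ) (k : ℕ) (v : n →₀ ℕ) : Prop :=
  v.degree = k ∧ ∃ w : n →₀ ℕ, w.degree = k ∧ toricDegree A w = toricDegree A v ∧ w ≺[m] v

theorem degree_monomial_sub_monomial {R : Type*} [CommRing R] [Nontrivial R] {u w : n →₀ ℕ}
    (h : w ≺[m] u) :
    m.degree (MvPolynomial.monomial u 1 - MvPolynomial.monomial w 1 : MvPolynomial n R) = u := by
  classical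
  have hdegree : ∀ v : n →₀ ℕ, m.degree (MvPolynomial.monomial v (1 : R)) = v := fun v => by
    rw [degree_monomial, if_neg one_ne_zero]
  rw [degree_sub_of_lt (by rwa [hdegree, hdegree]), hdegree]

theorem monomial_sub_monomial_ne_zero {R : Type*} [CommRing R] [Nontrivial R] {u w : n →₀ ℕ}
    (h : u ≠ w) :
    (MvPolynomial.monomial u 1 - MvPolynomial.monomial w 1 : MvPolynomial n R) ≠ 0 :=
  sub_ne_zero.mpr ((MvPolynomial.monomial_left_injective one_ne_zero).ne h)

theorem exists_toricDegree_eq_lt_degree {f : MvPolynomial n K} (hf : f ∈ toricIdeal K A)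
    (hf0 : f ≠ 0) :
    ∃ w ∈ f.support, toricDegree A w = toricDegree A (m.degree f) ∧ w ≺[m] m.degree f := by
  obtain ⟨w, hw, hne, hdeg⟩ := exists_mem_support_ne_toricDegree_eq hf (m.degree_mem_support hf0)
  exact ⟨w, hw, hdeg, lt_of_le_of_ne (m.le_degree hw) fun h => hne (m.toSyn.injective h)⟩

theorem isBinomialInitial_degree {g : MvPolynomial n K} (hg : g ∈ toricIdeal K A) (hg0 : g ≠ 0)
    (hk : g.IsHomogeneous k) : IsBinomialInitial m A k (m.degree g) := by
  obtain ⟨w, hw, hdeg, hlt⟩ := exists_toricDegree_eq_lt_degree hg hg0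
  have hdegree : ∀ v ∈ g.support, v.degree = k := fun v hv => by
    rw [Finsupp.degree_eq_weight_one]
    exact hk (MvPolynomial.mem_support_iff.mp hv)
  exact ⟨hdegree _ (m.degree_mem_support hg0), w, hdegree w hw, hdeg, hlt⟩

theorem IsBinomialInitial.exists_degree_eq {v : n →₀ ℕ} (hv : IsBinomialInitial m A k v) :
    ∃ g ∈ toricIdeal K A, g ≠ 0 ∧ g.IsHomogeneous k ∧ m.degree g = v := by
  obtain ⟨hvk, w, hwk, hdeg, hlt⟩ := hv
  have hne : v ≠ w := fun h => (h ▸ hlt).false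
  exact ⟨_, monomial_sub_monomial_mem_toricIdeal hdeg.symm, monomial_sub_monomial_ne_zero hne,
    (MvPolynomial.isHomogeneous_monomial _ hvk).sub (MvPolynomial.isHomogeneous_monomial _ hwk),
    degree_monomial_sub_monomial hlt⟩

theorem exists_eq_single_add_single_of_degree_eq_two {v : n →₀ ℕ} (hv : v.degree = 2) :
    ∃ x y, v = Finsupp.single x 1 + Finsupp.single y 1 := by
  classical
  obtain ⟨x, y, hxy⟩ := Multiset.card_eq_two.mp ((Finsupp.card_toMultiset v).trans hv)
  refine ⟨x, y, ?_⟩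
  rw [← Finsupp.toMultiset_toFinsupp v, hxy, Multiset.insert_eq_cons, ← Multiset.singleton_add,
    map_add, Multiset.toFinsupp_singleton, Multiset.toFinsupp_singleton]

theorem IsBinomialInitial.exists_col_add_col_eq {p q : n}
    (h : IsBinomialInitial m A 2 (Finsupp.single p 1 + Finsupp.single q 1)) :
    ∃ x y, A.col x + A.col y = A.col p + A.col q ∧
      Finsupp.single x 1 + Finsupp.single y 1 ≺[m] Finsupp.single p 1 + Finsupp.single q 1 := by
  obtain ⟨-, w, hw2, hdeg, hlt⟩ := h
  obtain ⟨x, y, rfl⟩ := exists_eq_single_add_single_of_degree_eq_two hw2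
  rw [toricDegree_single_add_single, toricDegree_single_add_single] at hdeg
  exact ⟨x, y, hdeg, hlt⟩

theorem exists_isGroebnerBasis_isHomogeneous_iff :
    (∃ B, IsGroebnerBasis m (toricIdeal K A) B ∧ ∀ g ∈ B, g.IsHomogeneous k) ↔
      ∀ u w : n →₀ ℕ, toricDegree A w = toricDegree A u → w ≺[m] u →
        ∃ v ≤ u, IsBinomialInitial m A k v := by
  simp only [isGroebnerBasis_iff_exists_degree_le]
  constructor
  · rintro ⟨B, ⟨hBI, hB⟩, hk⟩ u w hdeg hlt
    obtain ⟨g, hg, hg0, hle⟩ := hB _ (monomial_sub_monomial_mem_toricIdeal hdeg.symm)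
      (monomial_sub_monomial_ne_zero fun h => (h ▸ hlt).false)
    rw [degree_monomial_sub_monomial hlt] at hle
    exact ⟨m.degree g, hle, isBinomialInitial_degree (hBI hg) hg0 (hk g hg)⟩
  · intro h
    refine ⟨{g | g ∈ toricIdeal K A ∧ g.IsHomogeneous k}, ⟨fun g hg => hg.1, fun f hf hf0 => ?_⟩,
      fun g hg => hg.2⟩
    obtain ⟨w, -, hdeg, hlt⟩ := exists_toricDegree_eq_lt_degree (m := m) hf hf0
    obtain ⟨v, hvu, hv⟩ := h _ w hdeg hlt
    obtain ⟨g, hgI, hg0, hgk, rfl⟩ := hv.exists_degree_eq (K := K)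
    exact ⟨g, ⟨hgI, hgk⟩, hg0, hvu⟩

theorem hasLexQuadraticGroebnerBasis_toricIdeal_iff [Finite n] :
    HasLexQuadraticGroebnerBasis (toricIdeal K A) ↔ ∃ _ : LinearOrder n, ∀ u w : n →₀ ℕ,
      toricDegree A w = toricDegree A u → w ≺[.lex] u →
        ∃ v ≤ u, IsBinomialInitial .lex A 2 v :=
  exists_congr fun _ => exists_isGroebnerBasis_isHomogeneous_iff

end InitialMonomials

section Lex

open MonomialOrder

variable {n : Type*} [LinearOrder n]

theorem lex_lt_of_forall_lt [WellFoundedGT n] {u w : n →₀ ℕ} {j : n} (hj : j ∈ u.support)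
    (hw : ∀ k ∈ w.support, j < k) : w ≺[.lex] u := by
  have hu : u.support.Nonempty := ⟨j, hj⟩
  have hw0 : ∀ k ≤ u.support.min' hu, w k = 0 := fun k hk => Finsupp.notMem_support_iff.mp
    fun hkw => (hw k hkw).not_ge (hk.trans (u.support.min'_le j hj))
  rw [lex_lt_iff, Finsupp.Lex.lt_iff]
  refine ⟨u.support.min' hu, fun k hk => ?_, ?_⟩
  · have hk0 : u k = 0 := Finsupp.notMem_support_iff.mp fun hku =>
      (u.support.min'_le k hku).not_gt hk
    exact (hw0 k hk.le).trans hk0.symm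
  · exact (hw0 _ le_rfl).trans_lt
      (Nat.pos_of_ne_zero (Finsupp.mem_support_iff.mp (u.support.min'_mem hu)))

theorem lex_mapDomain_lt_iff {n' : Type*} [LinearOrder n'] [WellFoundedGT n] [WellFoundedGT n']
    {ι : n' → n} (hι : StrictMono ι) {u w : n' →₀ ℕ} :
    w.mapDomain ι ≺[.lex] u.mapDomain ι ↔ w ≺[.lex] u := by
  have hmono : StrictMono fun v : Lex (n' →₀ ℕ) => toLex ((ofLex v).mapDomain ι) := by
    intro v₁ v₂ h
    obtain ⟨i, hlt, hi⟩ := Finsupp.Lex.lt_iff.mp h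
    refine Finsupp.Lex.lt_iff.mpr ⟨ι i, fun j hj => ?_, ?_⟩
    · by_cases hrange : j ∈ Set.range ι
      · obtain ⟨k, rfl⟩ := hrange
        simpa only [ofLex_toLex, Finsupp.mapDomain_apply hι.injective]
          using hlt k (hι.lt_iff_lt.mp hj)
      · simp only [ofLex_toLex, Finsupp.mapDomain_of_notMem_range _ _ hrange]
    · simpa only [ofLex_toLex, Finsupp.mapDomain_apply hι.injective] using hi
  rw [lex_lt_iff, lex_lt_iff]
  exact hmono.lt_iff_lt

end Lex

section CoordinateFace

open MonomialOrder

variable {d d' n n' : Type*} {A : Matrix d n ℤ} {A' : Matrix d' n' ℤ} {ι : n' → n}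

/-- The configuration `A'` is, via `ι`, the subconfiguration of the nonnegative configuration `A`
cut out by the coordinate face on which the rows of `A` that vanish along `ι` vanish. Rows may be
repeated, so on the remaining rows only the sets of restricted rows are required to agree. -/
structure IsCoordinateFace (A' : Matrix d' n' ℤ) (A : Matrix d n ℤ) (ι : n' → n) : Prop where
  injective : Function.Injective ι
  nonneg : ∀ i j, 0 ≤ A i j
  exists_row : ∀ i', ∃ i, ∀ j', A i (ι j') = A' i' j'
  row_or_zero : ∀ i, (∃ i', ∀ j', A i (ι j') = A' i' j') ∨ ∀ j', A i (ι j') = 0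
  mem_range : ∀ j, (∀ i, (∀ j', A i (ι j') = 0) → A i j = 0) → j ∈ Set.range ι

theorem toricDegree_mapDomain_apply (u : n' →₀ ℕ) (i : d) :
    toricDegree A (u.mapDomain ι) i = u.sum fun j' k => k * A i (ι j') := by
  rw [toricDegree_apply, Finsupp.sum_mapDomain_index (by simp) (by simp [add_mul])]

theorem apply_eq_zero_of_toricDegree_eq_zero (hA : ∀ i j, 0 ≤ A i j) {u : n →₀ ℕ} {i : d}
    (hu : toricDegree A u i = 0) {j : n} (hj : j ∈ u.support) : A i j = 0 := by
  rw [toricDegree_apply, Finsupp.sum,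
    Finset.sum_eq_zero_iff_of_nonneg fun _ _ => mul_nonneg (Nat.cast_nonneg _) (hA _ _)] at hu
  exact (mul_eq_zero.mp (hu j hj)).resolve_left
    (Nat.cast_ne_zero.mpr (Finsupp.mem_support_iff.mp hj))

theorem exists_mapDomain_eq_of_support_subset (hι : Function.Injective ι) {v : n →₀ ℕ}
    (hv : ∀ j ∈ v.support, j ∈ Set.range ι) : ∃ v' : n' →₀ ℕ, v'.mapDomain ι = v :=
  ⟨v.comapDomain ι hι.injOn, Finsupp.mapDomain_comapDomain ι hι v hv⟩

theorem exists_mapDomain_eq_of_le_mapDomain (hι : Function.Injective ι) {u : n' →₀ ℕ} {v : n →₀ ℕ}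
    (hv : v ≤ u.mapDomain ι) : ∃ v' ≤ u, v'.mapDomain ι = v := by
  obtain ⟨v', rfl⟩ := exists_mapDomain_eq_of_support_subset hι (v := v) fun j hj => by
    by_contra hrange
    have hle := hv j
    rw [Finsupp.mapDomain_of_notMem_range _ _ hrange] at hle
    exact Finsupp.mem_support_iff.mp hj (Nat.le_zero.mp hle)
  refine ⟨v', fun j => ?_, rfl⟩
  simpa only [Finsupp.mapDomain_apply hι] using hv (ι j)

namespace IsCoordinateFace

theorem toricDegree_mapDomain_eq_iff (h : IsCoordinateFace A' A ι) {u w : n' →₀ ℕ} :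
    toricDegree A (w.mapDomain ι) = toricDegree A (u.mapDomain ι) ↔
      toricDegree A' w = toricDegree A' u := by
  simp only [funext_iff, toricDegree_mapDomain_apply]
  simp only [toricDegree_apply]
  refine ⟨fun hA i' => ?_, fun hA' i => ?_⟩
  · obtain ⟨i, hi⟩ := h.exists_row i'
    simpa only [hi] using hA i
  · rcases h.row_or_zero i with ⟨i', hi⟩ | hi
    · simpa only [hi] using hA' i'
    · simp [hi]

theorem exists_mapDomain_eq (h : IsCoordinateFace A' A ι) {u : n' →₀ ℕ} {w : n →₀ ℕ}
    (hw : toricDegree A w = toricDegree A (u.mapDomain ι)) :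
    ∃ w' : n' →₀ ℕ, w'.mapDomain ι = w := by
  refine exists_mapDomain_eq_of_support_subset h.injective fun j hj => h.mem_range j fun i hi => ?_
  refine apply_eq_zero_of_toricDegree_eq_zero h.nonneg ?_ hj
  simp [hw, toricDegree_mapDomain_apply, hi]

theorem hasLexQuadraticGroebnerBasis {K : Type*} [Field K] [Finite n] [Finite n']
    (h : IsCoordinateFace A' A ι) (hA : HasLexQuadraticGroebnerBasis (toricIdeal K A)) :
    HasLexQuadraticGroebnerBasis (toricIdeal K A') := by
  rw [hasLexQuadraticGroebnerBasis_toricIdeal_iff] at hA ⊢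
  obtain ⟨_, hA⟩ := hA
  let _ : LinearOrder n' := LinearOrder.lift' ι h.injective
  have hι : StrictMono ι := fun _ _ hlt => hlt
  refine ⟨inferInstance, fun u w hdeg hlt => ?_⟩
  obtain ⟨v, hvu, hv2, x, hx2, hdegx, hxv⟩ := hA (u.mapDomain ι) (w.mapDomain ι)
    (h.toricDegree_mapDomain_eq_iff.mpr hdeg) ((lex_mapDomain_lt_iff hι).mpr hlt)
  obtain ⟨v', hvu', rfl⟩ := exists_mapDomain_eq_of_le_mapDomain h.injective hvu
  obtain ⟨x', rfl⟩ := h.exists_mapDomain_eq hdegx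
  rw [Finsupp.degree_mapDomain] at hv2 hx2
  exact ⟨v', hvu', hv2, x', hx2, h.toricDegree_mapDomain_eq_iff.mp hdegx,
    (lex_mapDomain_lt_iff hι).mp hxv⟩

end IsCoordinateFace

end CoordinateFace

section Contraction

variable {V W : Type*} {G : SimpleGraph V} {H : SimpleGraph W} {f : V → W}

theorem cutVector_apply {C : Set V} {u v : V} (h : G.Adj u v) [Decidable (u ∈ C ↔ v ∈ C)] :
    cutVector G C ⟨s(u, v), h⟩ = if (u ∈ C ↔ v ∈ C) then 0 else 1 := by
  classical
  have hends : {x | x ∈ s(u, v)} = ({u, v} : Set V) := by ext; simp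
  simp only [cutVector, hends]
  by_cases hu : u ∈ C <;> by_cases hv : v ∈ C <;>
    simp [hu, hv, h.ne, Set.inter_insert_of_mem, Set.inter_insert_of_notMem]

theorem cutVector_apply_eq_zero_iff {C : Set V} {u v : V} (h : G.Adj u v) :
    cutVector G C ⟨s(u, v), h⟩ = 0 ↔ (u ∈ C ↔ v ∈ C) := by
  classical
  rw [cutVector_apply h, ite_eq_left_iff]
  simp

theorem cutMatrix_nonneg (i : G.edgeSet ⊕ Unit) (δ : CutVectors G) : 0 ≤ cutMatrix G i δ := by
  classical
  obtain ⟨_, C, rfl⟩ := δ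
  rcases i with e | _
  · change 0 ≤ cutVector G C e
    unfold cutVector
    split_ifs <;> simp
  · exact zero_le_one

/-- The map `f` contracts connected pieces of `G`: its fibres are connected. In terms of cuts, a
vertex set that contains both or neither of the ends of every edge collapsed by `f` is the preimage
of a vertex set. -/
def IsContraction (G : SimpleGraph V) (f : V → W) : Prop :=
  ∀ C : Set V, (∀ u v, G.Adj u v → f u = f v → (u ∈ C ↔ v ∈ C)) → ∃ D : Set W, f ⁻¹' D = C

theorem isContraction_of_injective (hf : Function.Injective f) : IsContraction G f :=
  fun C _ => ⟨f '' C, Set.preimage_image_eq C hf⟩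

theorem isContraction_quotMk {x y : V} (hxy : G.Adj x y) :
    IsContraction G (Quot.mk fun a b : V => a = x ∧ b = y) := by
  intro C hC
  have hCxy : x ∈ C ↔ y ∈ C := hC x y hxy (Quot.sound ⟨rfl, rfl⟩)
  exact ⟨Quot.lift (· ∈ C) (by rintro _ _ ⟨rfl, rfl⟩; exact propext hCxy), rfl⟩

open Classical in
/-- The pullback to `G` of a function on the edges of `G.map f`, extended by zero to the edges
collapsed by `f`. -/
noncomputable def edgePullback (G : SimpleGraph V) (f : V → W) (δ : (G.map f).edgeSet → ℤ) :
    G.edgeSet → ℤ :=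
  fun e => if h : e.1.map f ∈ (G.map f).edgeSet then δ ⟨e.1.map f, h⟩ else 0

theorem edgePullback_apply (δ : (G.map f).edgeSet → ℤ) {u v : V} (h : G.Adj u v)
    (hf : (G.map f).Adj (f u) (f v)) :
    edgePullback G f δ ⟨s(u, v), h⟩ = δ ⟨s(f u, f v), hf⟩ :=
  dif_pos hf

theorem edgePullback_apply_of_eq (δ : (G.map f).edgeSet → ℤ) {u v : V} (h : G.Adj u v)
    (hf : f u = f v) : edgePullback G f δ ⟨s(u, v), h⟩ = 0 :=
  dif_neg fun hadj : (G.map f).Adj (f u) (f v) => hadj.ne hf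

theorem edgePullback_injective : Function.Injective (edgePullback G f) := by
  rintro δ₁ δ₂ h
  funext ⟨e, he⟩
  induction e with
  | _ a b =>
    obtain ⟨-, u, v, huv, rfl, rfl⟩ := (SimpleGraph.map_adj' ..).mp he
    simpa only [edgePullback_apply _ huv he] using congrFun h ⟨s(u, v), huv⟩

theorem edgePullback_cutVector (D : Set W) :
    edgePullback G f (cutVector (G.map f) D) = cutVector G (f ⁻¹' D) := by
  classical
  funext ⟨e, he⟩
  induction e with
  | _ u v =>
    by_cases hf : f u = f v
    · rw [edgePullback_apply_of_eq _ he hf]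
      exact ((cutVector_apply_eq_zero_iff (C := f ⁻¹' D) he).mpr (by simp [hf])).symm
    · have hadj := SimpleGraph.map_adj_apply' he hf
      rw [edgePullback_apply _ he hadj, cutVector_apply hadj]
      exact (cutVector_apply (C := f ⁻¹' D) he).symm

/-- The map sending the cut vector of `G.map f` at `D` to the cut vector of `G` at `f ⁻¹' D`. -/
noncomputable def cutPullback (G : SimpleGraph V) (f : V → W) (δ : CutVectors (G.map f)) :
    CutVectors G :=
  ⟨edgePullback G f δ.1, by obtain ⟨_, D, rfl⟩ := δ; exact ⟨_, (edgePullback_cutVector D).symm⟩⟩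

theorem IsContraction.isCoordinateFace (hf : IsContraction G f) :
    IsCoordinateFace (cutMatrix (G.map f)) (cutMatrix G) (cutPullback G f) where
  injective _ _ h := Subtype.ext (edgePullback_injective (congrArg Subtype.val h))
  nonneg := cutMatrix_nonneg
  exists_row := by
    rintro (⟨e, he⟩ | _)
    · induction e with
      | _ a b =>
        obtain ⟨-, u, v, huv, rfl, rfl⟩ := (SimpleGraph.map_adj' ..).mp he
        exact ⟨.inl ⟨s(u, v), huv⟩, fun δ => edgePullback_apply δ.1 huv he⟩
    · exact ⟨.inr (), fun _ => rfl⟩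
  row_or_zero := by
    rintro (⟨e, he⟩ | _)
    · induction e with
      | _ u v =>
        by_cases huv : f u = f v
        · exact .inr fun δ => edgePullback_apply_of_eq δ.1 he huv
        · have hadj := SimpleGraph.map_adj_apply' he huv
          exact .inl ⟨.inl ⟨s(f u, f v), hadj⟩, fun δ => edgePullback_apply δ.1 he hadj⟩
    · exact .inl ⟨.inr (), fun _ => rfl⟩
  mem_range := by
    rintro ⟨_, C, rfl⟩ hC
    obtain ⟨D, rfl⟩ := hf C fun u v huv huv' => (cutVector_apply_eq_zero_iff huv).mp
      (hC (.inl ⟨s(u, v), huv⟩) fun δ => edgePullback_apply_of_eq δ.1 huv huv')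
    exact ⟨⟨_, D, rfl⟩, Subtype.ext (edgePullback_cutVector D)⟩

theorem IsContraction.hasLexQuadraticGroebnerBasis {K : Type*} [Field K] [Finite V] [Finite W]
    (hf : IsContraction G f) (hG : HasLexQuadraticGroebnerBasis (cutIdeal K G)) :
    HasLexQuadraticGroebnerBasis (cutIdeal K (G.map f)) :=
  hf.isCoordinateFace.hasLexQuadraticGroebnerBasis hG

theorem map_iso_eq (e : G ≃g H) : G.map e = H := by
  ext a b
  rw [SimpleGraph.map_adj']
  constructor
  · rintro ⟨-, u, v, huv, rfl, rfl⟩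
    exact e.map_adj_iff.mpr huv
  · exact fun hab => ⟨hab.ne, e.symm a, e.symm b, e.symm.map_adj_iff.mpr hab, by simp⟩

theorem ContractsTo.hasLexQuadraticGroebnerBasis {K : Type*} [Field K] [Finite W]
    (h : ContractsTo H G) [Finite V] (hG : HasLexQuadraticGroebnerBasis (cutIdeal K G)) :
    HasLexQuadraticGroebnerBasis (cutIdeal K H) := by
  revert ‹Finite V›
  induction h with
  | of_iso e =>
    intro _ hG
    rw [← map_iso_eq e]
    exact (isContraction_of_injective e.injective).hasLexQuadraticGroebnerBasis hG
  | contract hxy _ ih =>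
    intro _ hG
    exact ih ((isContraction_quotMk hxy).hasLexQuadraticGroebnerBasis hG)

end Contraction

section TwoCubes

open Finsupp MonomialOrder

/-- A vertex of one of two copies of the cube `{0, 1}^κ`. This is a structure rather than a
product so that it carries no order besides the given order of the variables. -/
@[ext]
structure CubeVertex (κ : Type*) where
  cube : Bool
  coord : κ → Bool

namespace CubeVertex

variable {κ : Type*}

instance [Finite κ] : Finite (CubeVertex κ) :=
  Finite.of_injective (fun p => (p.cube, p.coord)) fun p q h => by
    rw [Prod.mk_inj] at h
    exact CubeVertex.ext h.1 h.2

/-- The other end of the body diagonal through `p`. -/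
def antipode (p : CubeVertex κ) : CubeVertex κ :=
  ⟨p.cube, fun i => !p.coord i⟩

/-- The neighbour of `p` in its cube along the direction `i`. -/
def flip [DecidableEq κ] (p : CubeVertex κ) (i : κ) : CubeVertex κ :=
  ⟨p.cube, Function.update p.coord i (!p.coord i)⟩

theorem flip_ne_self [DecidableEq κ] (p : CubeVertex κ) (i : κ) : p.flip i ≠ p := fun h => by
  simpa [flip] using congrFun (congrArg coord h) i

end CubeVertex

/-- The free sum of two cubes of dimension `card κ`: the configuration of the vertices of two such
cubes that have only their centre in common. The row `(0, i)` is the `i`-th coordinate, which is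
reflected on the cube `true` in the row `(1, i)`; the last row is constant. -/
def twoCubesMatrix (κ : Type*) : Matrix ((Fin 2 × κ) ⊕ Unit) (CubeVertex κ) ℤ
  | .inl (j, i), p => ((![false, p.cube] j ^^ p.coord i).toNat : ℤ)
  | .inr _, _ => 1

variable {κ : Type*}

theorem toNat_add_toNat_eq_of_col_add_col_eq {x y p q : CubeVertex κ}
    (h : (twoCubesMatrix κ).col x + (twoCubesMatrix κ).col y =
      (twoCubesMatrix κ).col p + (twoCubesMatrix κ).col q) (j : Fin 2) (i : κ) :
    (![false, x.cube] j ^^ x.coord i).toNat + (![false, y.cube] j ^^ y.coord i).toNat =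
      (![false, p.cube] j ^^ p.coord i).toNat + (![false, q.cube] j ^^ q.coord i).toNat :=
  Nat.cast_injective (R := ℤ) (by push_cast; exact congrFun h (.inl (j, i)))

theorem eq_of_col_add_col_eq_col_add_self [Nonempty κ] {x y p : CubeVertex κ}
    (h : (twoCubesMatrix κ).col x + (twoCubesMatrix κ).col y =
      (twoCubesMatrix κ).col p + (twoCubesMatrix κ).col p) : x = p ∧ y = p := by
  have hrow := toNat_add_toNat_eq_of_col_add_col_eq h
  have hentry : ∀ i, (x.cube = p.cube ∧ x.coord i = p.coord i) ∧
      (y.cube = p.cube ∧ y.coord i = p.coord i) := by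
    intro i
    have h₀ := hrow 0 i
    have h₁ := hrow 1 i
    clear hrow h
    generalize x.cube = cx, y.cube = cy, p.cube = cp, x.coord i = a, y.coord i = b,
      p.coord i = c at *
    decide +revert
  obtain ⟨i₀⟩ := ‹Nonempty κ›
  exact ⟨CubeVertex.ext (hentry i₀).1.1 (funext fun i => (hentry i).1.2),
    CubeVertex.ext (hentry i₀).2.1 (funext fun i => (hentry i).2.2)⟩

theorem cube_eq_of_col_add_col_eq [Nonempty κ] {x y p q : CubeVertex κ} (hpq : p.cube ≠ q.cube)
    (h : (twoCubesMatrix κ).col x + (twoCubesMatrix κ).col y =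
      (twoCubesMatrix κ).col p + (twoCubesMatrix κ).col q) :
    (x.cube = p.cube ∧ y.cube = q.cube) ∨ (x.cube = q.cube ∧ y.cube = p.cube) := by
  obtain ⟨i⟩ := ‹Nonempty κ›
  have h₀ := toNat_add_toNat_eq_of_col_add_col_eq h 0 i
  have h₁ := toNat_add_toNat_eq_of_col_add_col_eq h 1 i
  clear h
  generalize x.cube = cx, y.cube = cy, p.cube = cp, q.cube = cq, x.coord i = a, y.coord i = b,
    p.coord i = c, q.coord i = d at *
  decide +revert

theorem coord_eq_of_col_add_col_eq {x y p q : CubeVertex κ} (hpq : p.cube ≠ q.cube)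
    (hx : x.cube = p.cube) (hy : y.cube = q.cube)
    (h : (twoCubesMatrix κ).col x + (twoCubesMatrix κ).col y =
      (twoCubesMatrix κ).col p + (twoCubesMatrix κ).col q) (i : κ) :
    x.coord i = p.coord i ∧ y.coord i = q.coord i := by
  have h₀ := toNat_add_toNat_eq_of_col_add_col_eq h 0 i
  have h₁ := toNat_add_toNat_eq_of_col_add_col_eq h 1 i
  rw [hx, hy] at h₀ h₁
  clear h hx hy
  generalize p.cube = cp, q.cube = cq, x.coord i = a, y.coord i = b, p.coord i = c,
    q.coord i = d at *
  decide +revert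

theorem sym2_eq_of_col_add_col_eq [Nonempty κ] {x y p q : CubeVertex κ} (hpq : p.cube ≠ q.cube)
    (h : (twoCubesMatrix κ).col x + (twoCubesMatrix κ).col y =
      (twoCubesMatrix κ).col p + (twoCubesMatrix κ).col q) : s(x, y) = s(p, q) := by
  rw [Sym2.eq_iff]
  rcases cube_eq_of_col_add_col_eq hpq h with ⟨hx, hy⟩ | ⟨hx, hy⟩
  · have hcoord := coord_eq_of_col_add_col_eq hpq hx hy h
    exact .inl ⟨CubeVertex.ext hx (funext fun i => (hcoord i).1),
      CubeVertex.ext hy (funext fun i => (hcoord i).2)⟩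
  · have hcoord := coord_eq_of_col_add_col_eq hpq.symm hx hy (h.trans (add_comm _ _))
    exact .inr ⟨CubeVertex.ext hx (funext fun i => (hcoord i).1),
      CubeVertex.ext hy (funext fun i => (hcoord i).2)⟩

theorem eq_antipode_of_col_add_col_eq [Nonempty κ] {x y r : CubeVertex κ}
    (h : (twoCubesMatrix κ).col x + (twoCubesMatrix κ).col y =
      (twoCubesMatrix κ).col r + (twoCubesMatrix κ).col r.antipode) : y = x.antipode := by
  have hrow := toNat_add_toNat_eq_of_col_add_col_eq h
  have hentry : ∀ i, y.cube = x.cube ∧ y.coord i = !x.coord i := by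
    intro i
    have h₀ := hrow 0 i
    have h₁ := hrow 1 i
    simp only [CubeVertex.antipode] at h₀ h₁
    clear hrow h
    generalize x.cube = cx, y.cube = cy, r.cube = cr, x.coord i = a, y.coord i = b,
      r.coord i = c at *
    decide +revert
  obtain ⟨i₀⟩ := ‹Nonempty κ›
  exact CubeVertex.ext (hentry i₀).1 (funext fun i => (hentry i).2)

theorem col_add_col_antipode_apply (r : CubeVertex κ) (j : Fin 2) (i : κ) :
    twoCubesMatrix κ (.inl (j, i)) r + twoCubesMatrix κ (.inl (j, i)) r.antipode = 1 := by
  simp only [twoCubesMatrix, CubeVertex.antipode]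
  cases ![false, r.cube] j <;> cases r.coord i <;> rfl

theorem col_flip_apply [DecidableEq κ] (p : CubeVertex κ) (j : Fin 2) (i k : κ) :
    twoCubesMatrix κ (.inl (j, i)) (p.flip k) = twoCubesMatrix κ (.inl (j, i)) p +
      if i = k then 1 - 2 * twoCubesMatrix κ (.inl (j, i)) p else 0 := by
  simp only [twoCubesMatrix, CubeVertex.flip, Function.update_apply]
  split_ifs with hik
  · subst hik
    cases ![false, p.cube] j <;> cases p.coord i <;> rfl
  · rw [add_zero]

theorem sum_col_flip [Fintype κ] [DecidableEq κ] {m : ℕ} (hm : Fintype.card κ = m + 2)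
    (p r : CubeVertex κ) :
    ∑ k, (twoCubesMatrix κ).col (p.flip k) = m • (twoCubesMatrix κ).col p +
      (twoCubesMatrix κ).col r + (twoCubesMatrix κ).col r.antipode := by
  ext (⟨j, i⟩ | _)
  · let a (q : CubeVertex κ) := twoCubesMatrix κ (.inl (j, i)) q
    calc (∑ k, (twoCubesMatrix κ).col (p.flip k)) (.inl (j, i))
        = Fintype.card κ * a p + (1 - 2 * a p) := by
          simp [a, Finset.sum_apply, col_flip_apply, Finset.sum_add_distrib]
      _ = m * a p + (a r + a r.antipode) := by
          rw [hm, col_add_col_antipode_apply]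
          push_cast
          ring
      _ = _ := by simp [a, add_assoc]
  · simp [Finset.sum_apply, twoCubesMatrix, hm, add_assoc, one_add_one_eq_two]

variable {m : MonomialOrder (CubeVertex κ)}

theorem IsBinomialInitial.ne_and_cube_eq [Nonempty κ] {p q : CubeVertex κ}
    (h : IsBinomialInitial m (twoCubesMatrix κ) 2 (single p 1 + single q 1)) :
    p ≠ q ∧ p.cube = q.cube := by
  obtain ⟨x, y, hcol, hlt⟩ := h.exists_col_add_col_eq
  constructor
  · rintro rfl
    obtain ⟨rfl, rfl⟩ := eq_of_col_add_col_eq_col_add_self hcol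
    exact hlt.false
  · by_contra hpq
    rcases Sym2.eq_iff.mp (sym2_eq_of_col_add_col_eq hpq hcol) with ⟨rfl, rfl⟩ | ⟨rfl, rfl⟩
    · exact hlt.false
    · exact (add_comm (single x 1) (single y 1) ▸ hlt).false

theorem IsBinomialInitial.exists_antipode_lt [Nonempty κ] {r : CubeVertex κ}
    (h : IsBinomialInitial m (twoCubesMatrix κ) 2 (single r 1 + single r.antipode 1)) :
    ∃ x : CubeVertex κ,
      single x 1 + single x.antipode 1 ≺[m] single r 1 + single r.antipode 1 := by
  obtain ⟨x, y, hcol, hlt⟩ := h.exists_col_add_col_eq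
  obtain rfl := eq_antipode_of_col_add_col_eq hcol
  exact ⟨x, hlt⟩

theorem IsBinomialInitial.eq_single_add_single_antipode [Nonempty κ] {p r : CubeVertex κ} {k : ℕ}
    (hpr : p.cube ≠ r.cube) {v : CubeVertex κ →₀ ℕ}
    (hv : v ≤ single p k + single r 1 + single r.antipode 1)
    (h : IsBinomialInitial m (twoCubesMatrix κ) 2 v) : v = single r 1 + single r.antipode 1 := by
  classical
  obtain ⟨x, y, rfl⟩ := exists_eq_single_add_single_of_degree_eq_two h.1
  have hsupport : ∀ z ∈ (single x 1 + single y 1 : CubeVertex κ →₀ ℕ).support,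
      z = p ∨ z = r ∨ z = r.antipode := by
    intro z hz
    by_contra! hne
    have hle := hv z
    simp only [Finsupp.add_apply, single_eq_of_ne hne.1, single_eq_of_ne hne.2.1,
      single_eq_of_ne hne.2.2] at hle
    exact mem_support_iff.mp hz (Nat.le_zero.mp hle)
  have hx := hsupport x (by simp)
  have hy := hsupport y (by simp)
  obtain ⟨hxy, hcube⟩ := h.ne_and_cube_eq
  grind [CubeVertex.antipode]

theorem toricDegree_sum_single_flip [Fintype κ] [DecidableEq κ] {k : ℕ}
    (hκ : Fintype.card κ = k + 2) (p r : CubeVertex κ) :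
    toricDegree (twoCubesMatrix κ) (∑ i, single (p.flip i) 1) =
      toricDegree (twoCubesMatrix κ) (single p k + single r 1 + single r.antipode 1) := by
  simp only [map_sum, map_add, toricDegree_single, one_smul]
  exact sum_col_flip hκ p r

theorem exists_forall_not_antipode_lt [Finite κ] (m : MonomialOrder (CubeVertex κ)) :
    ∃ r : CubeVertex κ, ∀ x : CubeVertex κ,
      ¬ single x 1 + single x.antipode 1 ≺[m] single r 1 + single r.antipode 1 := by
  have : Nonempty (CubeVertex κ) := ⟨⟨false, fun _ => false⟩⟩
  obtain ⟨r, hr⟩ := Finite.exists_min fun x : CubeVertex κ =>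
    m.toSyn (single x 1 + single x.antipode 1)
  exact ⟨r, fun x => (hr x).not_gt⟩

theorem sum_single_flip_lt [LinearOrder (CubeVertex κ)] [Fintype κ] [DecidableEq κ]
    {p : CubeVertex κ} (hp : ∀ q : CubeVertex κ, q.cube = p.cube → p ≤ q)
    {u : CubeVertex κ →₀ ℕ} (hu : p ∈ u.support) : ∑ i, single (p.flip i) 1 ≺[.lex] u := by
  refine lex_lt_of_forall_lt hu fun q hq => ?_
  obtain ⟨i, -, hi⟩ := Finset.mem_biUnion.mp (Finsupp.support_finsetSum hq)
  obtain rfl := Finset.mem_singleton.mp (support_single_subset hi)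
  exact lt_of_le_of_ne (hp _ rfl) (p.flip_ne_self i).symm

theorem not_hasLexQuadraticGroebnerBasis_toricIdeal_twoCubesMatrix (K : Type*) [Field K]
    [Fintype κ] (hκ : 3 ≤ Fintype.card κ) :
    ¬ HasLexQuadraticGroebnerBasis (toricIdeal K (twoCubesMatrix κ)) := by
  classical
  have : Nonempty κ := Fintype.card_pos_iff.mp (by omega)
  rw [hasLexQuadraticGroebnerBasis_toricIdeal_iff]
  rintro ⟨_, hlex⟩
  obtain ⟨r, hr⟩ := exists_forall_not_antipode_lt (.lex : MonomialOrder (CubeVertex κ))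
  obtain ⟨p, hp, hpmin⟩ := Set.exists_min_image {p : CubeVertex κ | p.cube = !r.cube} id
    (Set.toFinite _) ⟨⟨!r.cube, r.coord⟩, rfl⟩
  obtain ⟨k, hk⟩ := Nat.exists_eq_add_of_le' (show 2 ≤ Fintype.card κ by omega)
  have hk0 : k ≠ 0 := by omega
  obtain ⟨v, hvu, hv⟩ := hlex (single p k + single r 1 + single r.antipode 1)
    (∑ i, single (p.flip i) 1) (toricDegree_sum_single_flip hk p r)
    (sum_single_flip_lt (fun q hq => hpmin q (hq.trans hp)) (by simp [hk0]))
  obtain rfl := hv.eq_single_add_single_antipode (by simp [show p.cube = !r.cube from hp]) hvu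
  obtain ⟨x, hx⟩ := hv.exists_antipode_lt
  exact hr x hx

end TwoCubes

section CompleteBipartite

variable {V : Type*} {G : SimpleGraph V}

theorem cutVector_compl (C : Set V) : cutVector G Cᶜ = cutVector G C := by
  classical
  funext ⟨e, he⟩
  induction e with
  | _ u v =>
    refine (cutVector_apply he).trans (Eq.trans ?_ (cutVector_apply (C := C) he).symm)
    simp only [Set.mem_compl_iff, not_iff_not]

theorem cutVector_apply_of_bool (χ : V → Bool) {u v : V} (h : G.Adj u v) :
    cutVector G {x | χ x = true} ⟨s(u, v), h⟩ = ((χ u ^^ χ v).toNat : ℤ) := by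
  classical
  cases hu : χ u <;> cases hv : χ v <;> simp [cutVector_apply h, hu, hv]

variable {κ : Type*}

/-- The cut vector of `K_{2,κ}` that corresponds to a vertex of the two cubes: the cut avoids the
first of the two vertices of degree `card κ`, and the cube records the side of the second one. -/
noncomputable def bipartiteCut (p : CubeVertex κ) : CutVectors (completeBipartiteGraph (Fin 2) κ) :=
  ⟨_, {x | Sum.elim ![false, p.cube] p.coord x = true}, rfl⟩

/-- The edge of `K_{2,κ}` that joins the vertices `j` and `i`. -/
def bipartiteEdge (j : Fin 2) (i : κ) : (completeBipartiteGraph (Fin 2) κ).edgeSet :=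
  ⟨s(.inl j, .inr i), by simp⟩

theorem exists_bipartiteEdge_eq (e : (completeBipartiteGraph (Fin 2) κ).edgeSet) :
    ∃ j i, bipartiteEdge j i = e := by
  obtain ⟨e, he⟩ := e
  induction e with
  | _ u v =>
    rcases u with j | i <;> rcases v with j' | i'
    · simp at he
    · exact ⟨j, i', rfl⟩
    · exact ⟨j', i, Subtype.ext Sym2.eq_swap⟩
    · simp at he

theorem cutMatrix_bipartiteEdge_bipartiteCut (j : Fin 2) (i : κ) (p : CubeVertex κ) :
    cutMatrix _ (.inl (bipartiteEdge j i)) (bipartiteCut p) = twoCubesMatrix κ (.inl (j, i)) p :=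
  cutVector_apply_of_bool (Sum.elim ![false, p.cube] p.coord) (bipartiteEdge j i).2

theorem bipartiteCut_injective [Nonempty κ] : Function.Injective (bipartiteCut (κ := κ)) := by
  intro p q h
  have hcol : (twoCubesMatrix κ).col p = (twoCubesMatrix κ).col q := by
    ext (⟨j, i⟩ | _)
    · simp only [Matrix.col_apply, ← cutMatrix_bipartiteEdge_bipartiteCut, h]
    · rfl
  exact (eq_of_col_add_col_eq_col_add_self (by rw [hcol])).1

theorem bipartiteCut_surjective : Function.Surjective (bipartiteCut (κ := κ)) := by
  classical
  have hcut : ∀ C : Set (Fin 2 ⊕ κ), .inl 0 ∉ C →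
      ∃ p, (bipartiteCut p).1 = cutVector (completeBipartiteGraph (Fin 2) κ) C := by
    intro C hC
    refine ⟨⟨decide (.inl 1 ∈ C), fun i => decide (.inr i ∈ C)⟩, congrArg (cutVector _) ?_⟩
    ext (j | i)
    · fin_cases j <;> simp [hC]
    · simp
  rintro ⟨_, C, rfl⟩
  by_cases hC : .inl 0 ∈ C
  · obtain ⟨p, hp⟩ := hcut Cᶜ (by simpa using hC)
    exact ⟨p, Subtype.ext (hp.trans (cutVector_compl C))⟩
  · obtain ⟨p, hp⟩ := hcut C hC
    exact ⟨p, Subtype.ext hp⟩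

theorem isCoordinateFace_bipartiteCut [Nonempty κ] :
    IsCoordinateFace (twoCubesMatrix κ) (cutMatrix (completeBipartiteGraph (Fin 2) κ))
      bipartiteCut where
  injective := bipartiteCut_injective
  nonneg := cutMatrix_nonneg
  exists_row := by
    rintro (⟨j, i⟩ | _)
    · exact ⟨.inl (bipartiteEdge j i), cutMatrix_bipartiteEdge_bipartiteCut j i⟩
    · exact ⟨.inr (), fun _ => rfl⟩
  row_or_zero := by
    rintro (e | _)
    · obtain ⟨j, i, rfl⟩ := exists_bipartiteEdge_eq e
      exact .inl ⟨.inl (j, i), cutMatrix_bipartiteEdge_bipartiteCut j i⟩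
    · exact .inl ⟨.inr (), fun _ => rfl⟩
  mem_range δ _ := bipartiteCut_surjective δ

end CompleteBipartite

theorem mainTheorem4_general (K : Type*) [Field K] {κ : Type*} (hκ : 3 ≤ Nat.card κ)
    {V : Type*} [Finite V] (G : SimpleGraph V)
    (hG : ContractsTo (completeBipartiteGraph (Fin 2) κ) G) :
    ¬ HasLexQuadraticGroebnerBasis (cutIdeal K G) := by
  have : Finite κ := Nat.finite_of_card_ne_zero (by omega)
  have : Nonempty κ := (Nat.card_pos_iff.mp (by omega)).1
  cases nonempty_fintype κ
  intro h
  exact not_hasLexQuadraticGroebnerBasis_toricIdeal_twoCubesMatrix K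
    (Nat.card_eq_fintype_card (α := κ) ▸ hκ)
    (isCoordinateFace_bipartiteCut.hasLexQuadraticGroebnerBasis
      (hG.hasLexQuadraticGroebnerBasis h))

theorem mainTheorem4 (K : Type*) [Field K] {V : Type*} [Finite V] (G : SimpleGraph V)
    (hG : ContractsTo (completeBipartiteGraph (Fin 2) (Fin 3)) G) :
    ¬ HasLexQuadraticGroebnerBasis (cutIdeal K G) :=
  mainTheorem4_general K (by simp) G hG
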